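/- **Setting.** For $X=(X_{ij})$ put $\|X\|_{F,2}=(\sum_{i,j}|X_{ij}|^2)^{1/2}$ and $\|X\|_{F,1}=\sum_{i,j}|X_{ij}|$. For $Y\in\mathbb R^{M\times N}$, $p\in\mathbb N$ and $\alpha,\nu,\gamma\ge 0$ define, on triples of entrywise non-negative matrices $U\in\mathbb R^{M\times p}$, $\Sigma\in\mathbb R^{p\times p}$, $V\in\mathbb R^{p\times N}$, $$\mathcal J_p^{\alpha,\nu,\gamma}(U,\Sigma,V)=\|Y-U\Sigma V\|_{F,2}^2+\gamma\|\Sigma\|_{F,1}+\nu\|U\|_{F,1}+\nu\|V\|_{F,1}+\alpha\|U^TU-I_p\|_{F,1}+\alpha\|VV^T-I_p\|_{F,1}.$$ Let $0<C_1<C_2$. Let $Y$ be a random $M\times N$ matrix, $N,M\ge1$, whose rows (or whose columns) are i.i.d. random vectors in the unit cube $[0,1]^d$ ($d=N$, respectively $d=M$) with a density $f$ with respect to Lebesgue measure satisfying $C_1<f<C_2$ on the cube, and let $(\tilde U_p,\tilde\Sigma_p,\tilde V_p)$ be, almost surely, a minimizer of $\mathcal J_p^{\alpha,\nu,\gamma}$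 over such non-negative triples. For $l\in\mathbb N$ put $$\mu(N,M,l)=\tfrac{l(l-1)}2+MN-|N-M|-1 .$$ **Theorem.** For every $\eta\in(0,1)$ there is $K_\eta>0$ depending only on $\eta$, and there are constants $C_3>0$ and $\delta_0>0$ depending only on $C_1,C_2$, such that the following holds for all $K>1$, $N,M\ge 1$ and $0<\delta<\delta_0$. Put $\varepsilon=\delta\,(KNM+\min(N,M)^2)^{-1}$, $$a_l=\left(l^{\max(N,M)}-(l-1)^{\max(N,M)}\right)\,l!\,\min(N,M)\,(C_3\varepsilon)^{\mu(N,M,l)},\qquad p_{N,M,\delta}=\sqrt{\frac{\max(N,M)}{|\log(C_3\varepsilon)|}} .$$ 1. If $p\le\min(N,M)$ and $\gamma+2\nu\le(K-1)\varepsilon$, then $$\mathbb P\left(\mathcal J_p^{\alpha,\nu,\gamma}(\tilde U_p,\tilde\Sigma_p,\tilde V_p)<\delta\right)\ \ge\ \sum_{l=1}^p a_l .$$ 2. For every $\eta\in(0,1)$ the growth of this sum in $p$ is controlled by $\eta$ beyond $K_\eta\,p_{N,M,\delta}$: for every integer $p>K_\eta\,p_{N,M,\delta}$, $$a_{p+1}\le\eta\,a_p\qquad\text{and}\qquad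 \sum_{l=p+1}^{q}a_l\le\frac{\eta}{1-\eta}\,a_p\quad\text{for all integers } q\ge p .$$ The threshold is of the same order as $p_{N,M,\delta}$: for every integer $p$ with $1\le p\le K_\eta^{-1}p_{N,M,\delta}$ one has $a_{p+1}>\eta\,a_p$. -/

import Mathlib

open MeasureTheory ProbabilityTheory
open scoped Nat Matrix

namespace NMF

noncomputable section

/-- The Frobenius norm `‖X‖_{F,2} = (∑ |X i j|²)^{1/2}`. -/
def frobTwo {m n : ℕ} (X : Matrix (Fin m) (Fin n) ℝ) : ℝ :=
  Real.sqrt (∑ i, ∑ j, |X i j| ^ 2)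

/-- The entrywise `ℓ¹` norm `‖X‖_{F,1} = ∑ |X i j|`. -/
def frobOne {m n : ℕ} (X : Matrix (Fin m) (Fin n) ℝ) : ℝ :=
  ∑ i, ∑ j, |X i j|

/-- Entrywise non-negativity. -/
def Nonneg {m n : ℕ} (X : Matrix (Fin m) (Fin n) ℝ) : Prop :=
  ∀ i j, 0 ≤ X i j

/-- The tri-factorization functional. The `p` columns of `U` and the `p` rows of `V` are the basis
vectors, and their `p × p` Gram matrices are compared with the identity. -/
def J {M N p : ℕ} (α ν γ : ℝ) (Y : Matrix (Fin M) (Fin N) ℝ)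
    (U : Matrix (Fin M) (Fin p) ℝ) (S : Matrix (Fin p) (Fin p) ℝ)
    (V : Matrix (Fin p) (Fin N) ℝ) : ℝ :=
  frobTwo (Y - U * S * V) ^ 2 + γ * frobOne S + ν * frobOne U + ν * frobOne V
    + α * frobOne (Uᵀ * U - 1) + α * frobOne (V * Vᵀ - 1)

/-- `(U, S, V)` minimizes the functional among all triples of non-negative matrices. -/
def IsMinimizer {M N p : ℕ} (α ν γ : ℝ) (Y : Matrix (Fin M) (Fin N) ℝ)
    (U : Matrix (Fin M) (Fin p) ℝ) (S : Matrix (Fin p) (Fin p) ℝ)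
    (V : Matrix (Fin p) (Fin N) ℝ) : Prop :=
  (Nonneg U ∧ Nonneg S ∧ Nonneg V) ∧
    ∀ (U' : Matrix (Fin M) (Fin p) ℝ) (S' : Matrix (Fin p) (Fin p) ℝ)
      (V' : Matrix (Fin p) (Fin N) ℝ), Nonneg U' → Nonneg S' → Nonneg V' →
      J α ν γ Y U S V ≤ J α ν γ Y U' S' V'

/-- `X 0, …, X (n-1)` are i.i.d. random vectors in `[0,1]^d` whose common law has a density `f`
with respect to Lebesgue measure on the cube, with `C₁ < f < C₂` there. -/
def IsIIDWithDensity {Ω : Type*} [MeasurableSpace Ω] (P : Measure Ω) {n d : ℕ}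
    (C₁ C₂ : ℝ) (X : Fin n → Ω → (Fin d → ℝ)) : Prop :=
  (∀ i, Measurable (X i)) ∧ iIndepFun X P ∧
    ∃ f : (Fin d → ℝ) → ℝ, Measurable f ∧
      (∀ x ∈ Set.Icc (0 : Fin d → ℝ) 1, C₁ < f x ∧ f x < C₂) ∧
      ∀ i, P.map (X i) =
        (volume.restrict (Set.Icc (0 : Fin d → ℝ) 1)).withDensity
          (fun x => ENNReal.ofReal (f x))

/-- A random image: its rows, or its columns, are i.i.d. in the unit cube with a density
between `C₁` and `C₂`. -/
def IsRandomImage {Ω : Type*} [MeasurableSpace Ω] (P : Measure Ω) {M N : ℕ}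
    (C₁ C₂ : ℝ) (Y : Ω → Matrix (Fin M) (Fin N) ℝ) : Prop :=
  IsIIDWithDensity P C₁ C₂ (fun (i : Fin M) (ω : Ω) (j : Fin N) => Y ω i j) ∨
    IsIIDWithDensity P C₁ C₂ (fun (j : Fin N) (ω : Ω) (i : Fin M) => Y ω i j)

/-- `ε = δ (K N M + min(N,M)²)⁻¹`. -/
def eps (K : ℝ) (N M : ℕ) (δ : ℝ) : ℝ :=
  δ * (K * N * M + (min N M : ℝ) ^ 2)⁻¹

/-- `μ(N,M,l) = l(l-1)/2 + MN - |N-M| - 1`. -/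
def mu (N M l : ℕ) : ℝ :=
  (l : ℝ) * ((l : ℝ) - 1) / 2 + (M : ℝ) * N - |(N : ℝ) - M| - 1

/-- The `l`-th term
`(l^{max(N,M)} - (l-1)^{max(N,M)}) l! min(N,M) t^{μ(N,M,l)}`, to be used with `t = C₃ ε`. -/
def term (N M : ℕ) (t : ℝ) (l : ℕ) : ℝ :=
  ((l : ℝ) ^ max N M - ((l : ℝ) - 1) ^ max N M) * (l ! : ℝ) * (min N M : ℝ) * t ^ mu N M l

/-- `∑_{l=1}^p` of the terms. -/
def boundSum (N M : ℕ) (t : ℝ) (p : ℕ) : ℝ :=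
  ∑ l ∈ Finset.Icc 1 p, term N M t l

/-- `p_{N,M,δ} = (max(N,M) / |log t|)^{1/2}`, to be used with `t = C₃ ε`. -/
def pOpt (N M : ℕ) (t : ℝ) : ℝ :=
  Real.sqrt ((max N M : ℝ) / |Real.log t|)

end

end NMF

/-! ### Competitors built from rank one matrices. -/

namespace NMF

/-! The bound is so small that rank one competitors suffice. Write m, n for the max and min of N, M
and t = C₃ε. The exponent is (m+1)(n-1) + l(l-1)/2, and the sum is at most (2t)^((m+1)(n-1))
(`boundSum_le`). For the probability, a rank one matrix `a bᵀ` with entries in [0,1] factors through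
orthonormal non-negative `U`, `V`, so the α-penalties vanish and the others cost at most (γ+2ν)MN
(`IsMinimizer.J_le`). If n = 1, `Y` is itself rank one; if n ≥ 2, it is enough that all entries of
`Y` lie within √ε of 1/2, an event of probability at least c^m (2√ε)^(mn), and mn ≤ 2(m+1)(n-1).

For the growth, a_{p+1}/a_p is the ratio of consecutive differences of m-th powers times (p+1)t^p.
The former lies between exp(m/(2p)) - 1 and exp(m/p), and t^p = exp(-p|log t|), so the comparison
turns on p² against m/|log t|. -/

/-- A vector with entries in `[0,1]` is a non-negative combination of `p` orthonormal non-negative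
vectors with disjoint supports. -/
lemma exists_orthonormal_factor {M p : ℕ} (hp : 1 ≤ p) (hpM : p ≤ M) (a : Fin M → ℝ)
    (h0 : ∀ i, 0 ≤ a i) (h1 : ∀ i, a i ≤ 1) :
    ∃ (U : Matrix (Fin M) (Fin p) ℝ) (s : Fin p → ℝ), Nonneg U ∧ (∀ j, 0 ≤ s j) ∧
      Uᵀ * U = 1 ∧ (∀ i, ∑ j, U i j * s j = a i) ∧ frobOne U ≤ M ∧ ∑ j, s j ≤ M := by
  obtain ⟨g, hg⟩ : ∃ g : Fin M → Fin p, Function.Surjective g := by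
    -- The fibres of `g` split the coordinates into `p` nonempty blocks; column `j` of `U` will be
    -- `a` restricted to block `j`, normalized.
    refine ⟨fun i => ⟨min i.1 (p - 1), by omega⟩, fun j => ⟨⟨j.1, by omega⟩, ?_⟩⟩
    ext
    simp only
    omega
  have key : ∀ j, ∃ (w : Fin M → ℝ) (s : ℝ), (∀ i, 0 ≤ w i) ∧ (∀ i, g i ≠ j → w i = 0) ∧
      ∑ i, w i * w i = 1 ∧ 0 ≤ s ∧ (∀ i, g i = j → w i * s = a i) ∧
      s ≤ ∑ i, if g i = j then a i else 0 := by
    intro j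
    set b : Fin M → ℝ := fun i => if g i = j then a i else 0 with hb
    have hb0 : ∀ i, 0 ≤ b i := fun i => by
      simp only [hb]; split_ifs
      exacts [h0 i, le_rfl]
    have hq0 : 0 ≤ ∑ i, b i ^ 2 := Finset.sum_nonneg fun i _ => sq_nonneg _
    rcases hq0.eq_or_lt with hq | hq
    -- If `a` vanishes on the block, a unit coordinate vector in it, with coefficient 0, keeps the
    -- columns orthonormal.
    · obtain ⟨i₀, hi₀⟩ := hg j
      have hbz : ∀ i, b i = 0 := fun i => by
        have := (Finset.sum_eq_zero_iff_of_nonneg (fun i _ => sq_nonneg (b i))).1 hq.symm i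
          (Finset.mem_univ i)
        exact pow_eq_zero_iff two_ne_zero |>.1 this
      refine ⟨Pi.single i₀ 1, 0, fun i => ?_, fun i hi => ?_, ?_, le_rfl, fun i hi => ?_,
        Finset.sum_nonneg fun i _ => hb0 i⟩
      · by_cases h : i = i₀
        · subst h; simp
        · simp [h]
      · have h : i ≠ i₀ := by rintro rfl; exact hi hi₀
        simp [h]
      · simp [Pi.single_apply]
      · have := hbz i
        simp only [hb, if_pos hi] at this
        simp [this]
    · have hs : 0 < √(∑ i, b i ^ 2) := Real.sqrt_pos.2 hq
      refine ⟨fun i => b i / √(∑ i, b i ^ 2), √(∑ i, b i ^ 2),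
        fun i => div_nonneg (hb0 i) hs.le, fun i hi => by simp [hb, hi], ?_, hs.le,
        fun i hi => ?_, ?_⟩
      · have : ∀ i, b i / √(∑ i, b i ^ 2) * (b i / √(∑ i, b i ^ 2)) =
            b i ^ 2 / ∑ i, b i ^ 2 := fun i => by
          rw [div_mul_div_comm, Real.mul_self_sqrt hq0, sq]
        simp_rw [this, ← Finset.sum_div]
        exact div_self hq.ne'
      · simp only [hb, if_pos hi] at hs ⊢
        rw [div_mul_cancel₀ _ hs.ne']
      · rw [Real.sqrt_le_left (Finset.sum_nonneg fun i _ => hb0 i)]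
        exact Finset.sum_sq_le_sq_sum_of_nonneg fun i _ => hb0 i
  choose w s hw0 hws hw1 hs0 hwa hsle using key
  have hwle : ∀ j i, w j i ≤ 1 := fun j i => by
    have : w j i * w j i ≤ ∑ i, w j i * w j i :=
      Finset.single_le_sum (f := fun i => w j i * w j i)
        (fun i _ => mul_self_nonneg _) (Finset.mem_univ i)
    rw [hw1] at this
    nlinarith [hw0 j i]
  refine ⟨Matrix.of fun i j => w j i, s, fun i j => hw0 j i, hs0, ?_, fun i => ?_, ?_, ?_⟩
  · ext j k
    rw [Matrix.mul_apply, Matrix.one_apply]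
    simp only [Matrix.transpose_apply, Matrix.of_apply]
    split_ifs with h
    · subst h; exact hw1 j
    · refine Finset.sum_eq_zero fun i _ => ?_
      by_cases hj : g i = j
      · rw [hws k i (by rw [hj]; exact h), mul_zero]
      · rw [hws j i hj, zero_mul]
  · rw [Finset.sum_eq_single (g i)]
    · exact hwa _ i rfl
    · intro j _ hj
      simp [hws j i (Ne.symm hj)]
    · simp
  · unfold frobOne
    -- Disjoint supports leave at most one nonzero entry in each row.
    calc ∑ i, ∑ j, |w j i| ≤ ∑ i : Fin M, (1 : ℝ) := Finset.sum_le_sum fun i _ => by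
          rw [Finset.sum_eq_single (g i)]
          · rw [abs_of_nonneg (hw0 _ _)]; exact hwle _ _
          · intro j _ hj
            simp [hws j i (Ne.symm hj)]
          · simp
      _ = M := by simp
  · calc ∑ j, s j ≤ ∑ j, ∑ i, if g i = j then a i else 0 :=
          Finset.sum_le_sum fun j _ => hsle j
      _ = ∑ i, a i := by rw [Finset.sum_comm]; simp
      _ ≤ ∑ i : Fin M, (1 : ℝ) := Finset.sum_le_sum fun i _ => h1 i
      _ = M := by simp

lemma frobOne_zero {m n : ℕ} : frobOne (0 : Matrix (Fin m) (Fin n) ℝ) = 0 := by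
  simp [frobOne]

lemma frobOne_transpose {m n : ℕ} (X : Matrix (Fin m) (Fin n) ℝ) : frobOne Xᵀ = frobOne X := by
  unfold frobOne
  rw [Finset.sum_comm]
  rfl

/-- The minimum of the functional is controlled by the squared distance to any rank one matrix
`a bᵀ` with entries in `[0,1]`. -/
lemma IsMinimizer.J_le {M N p : ℕ} (hp : 1 ≤ p) (hM : p ≤ M) (hN : p ≤ N) {α ν γ : ℝ}
    (hν : 0 ≤ ν) (hγ : 0 ≤ γ) {Y : Matrix (Fin M) (Fin N) ℝ} {U : Matrix (Fin M) (Fin p) ℝ}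
    {S : Matrix (Fin p) (Fin p) ℝ} {V : Matrix (Fin p) (Fin N) ℝ}
    (h : IsMinimizer α ν γ Y U S V) (a : Fin M → ℝ) (b : Fin N → ℝ)
    (ha0 : ∀ i, 0 ≤ a i) (ha1 : ∀ i, a i ≤ 1) (hb0 : ∀ i, 0 ≤ b i) (hb1 : ∀ i, b i ≤ 1) :
    J α ν γ Y U S V ≤ ∑ i, ∑ j, |Y i j - a i * b j| ^ 2 + (γ + 2 * ν) * (M * N) := by
  obtain ⟨A, s, hA0, hs0, hA, hAs, hA1, hs1⟩ := exists_orthonormal_factor hp hM a ha0 ha1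
  obtain ⟨B, r, hB0, hr0, hB, hBr, hB1, hr1⟩ := exists_orthonormal_factor hp hN b hb0 hb1
  refine (h.2 A (Matrix.of fun j k => s j * r k) Bᵀ hA0 (fun j k => mul_nonneg (hs0 j) (hr0 k))
    (fun j k => hB0 k j)).trans ?_
  have hS : frobOne (Matrix.of fun j k => s j * r k) ≤ M * N := by
    unfold frobOne
    have : ∀ j k, |s j * r k| = s j * r k := fun j k => abs_of_nonneg (mul_nonneg (hs0 j) (hr0 k))
    simp only [Matrix.of_apply, this]
    rw [← Finset.sum_mul_sum]
    exact mul_le_mul hs1 hr1 (Finset.sum_nonneg fun _ _ => hr0 _) (Nat.cast_nonneg _)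
  have hprod : A * (Matrix.of fun j k => s j * r k) * Bᵀ = Matrix.of fun i j => a i * b j := by
    ext i j
    simp only [Matrix.mul_apply, Matrix.of_apply, Matrix.transpose_apply]
    rw [← hAs i, ← hBr j, Finset.mul_sum]
    refine Finset.sum_congr rfl fun k _ => ?_
    rw [Finset.sum_mul, Finset.sum_mul]
    exact Finset.sum_congr rfl fun l _ => by ring
  unfold J
  rw [hprod, Matrix.transpose_transpose, hA, hB, sub_self, frobOne_zero, frobOne_transpose]
  unfold frobTwo
  rw [Real.sq_sqrt (Finset.sum_nonneg fun _ _ => Finset.sum_nonneg fun _ _ => sq_nonneg _)]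
  simp only [Matrix.sub_apply, Matrix.of_apply]
  have hM1 : (1 : ℝ) ≤ M := by exact_mod_cast hp.trans hM
  have hN1 : (1 : ℝ) ≤ N := by exact_mod_cast hp.trans hN
  have e1 := mul_le_mul_of_nonneg_left hS hγ
  have e2 : ν * frobOne A + ν * frobOne B ≤ 2 * ν * (M * N) := by
    have : (M : ℝ) + N ≤ 2 * (M * N) := by nlinarith
    nlinarith
  linarith

/-! ### Probability of small boxes. -/

/-- Lower bound for the probability that all entries are within `ρ` of `1/2`. -/
lemma IsIIDWithDensity.le_measureReal_box {Ω : Type*} [MeasurableSpace Ω] {P : Measure Ω}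
    [IsProbabilityMeasure P] {n d : ℕ} {C₁ C₂ : ℝ} {X : Fin n → Ω → (Fin d → ℝ)} (hC : 0 ≤ C₁)
    (h : IsIIDWithDensity P C₁ C₂ X) {ρ : ℝ} (hρ0 : 0 ≤ ρ) (hρ : ρ ≤ 1 / 2) :
    C₁ ^ n * (2 * ρ) ^ (n * d) ≤ P.real {ω | ∀ i j, |X i ω j - 1 / 2| ≤ ρ} := by
  obtain ⟨hm, hind, f, hf, hfC, hlaw⟩ := h
  set B : Set (Fin d → ℝ) := Set.Icc (fun _ => 1 / 2 - ρ) (fun _ => 1 / 2 + ρ) with hB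
  have hBm : MeasurableSet B := measurableSet_Icc
  have hBI : B ⊆ Set.Icc 0 1 := by
    refine Set.Icc_subset_Icc (fun _ => ?_) (fun _ => ?_) <;> simp <;> linarith
  have hset : {ω | ∀ i j, |X i ω j - 1 / 2| ≤ ρ} = ⋂ i ∈ Finset.univ, X i ⁻¹' B := by
    ext ω
    simp only [Set.mem_ofPred_eq, Finset.mem_univ, Set.iInter_true, Set.mem_iInter,
      Set.mem_preimage, hB, Set.mem_Icc, Pi.le_def, ← forall_and]
    refine forall_congr' fun i => forall_congr' fun j => ?_
    rw [abs_le]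
    constructor <;> rintro ⟨h1, h2⟩ <;> constructor <;> linarith
  have hvol : (volume : Measure (Fin d → ℝ)) B = ENNReal.ofReal ((2 * ρ) ^ d) := by
    rw [hB, Real.volume_Icc_pi]
    simp only [Finset.prod_const, Finset.card_univ, Fintype.card_fin]
    rw [ENNReal.ofReal_pow (by linarith)]
    congr 2
    ring
  have hi : ∀ i, ENNReal.ofReal (C₁ * (2 * ρ) ^ d) ≤ P (X i ⁻¹' B) := fun i => by
    rw [← Measure.map_apply (hm i) hBm, hlaw, withDensity_apply _ hBm,
      Measure.restrict_restrict hBm, Set.inter_eq_left.2 hBI, ENNReal.ofReal_mul hC, ← hvol,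
      ← setLIntegral_const]
    exact setLIntegral_mono' hBm fun x hx => ENNReal.ofReal_le_ofReal (hfC x (hBI hx)).1.le
  have hfin := hind.measure_inter_preimage_eq_mul Finset.univ (sets := fun _ => B) fun _ _ => hBm
  have : ENNReal.ofReal (C₁ ^ n * (2 * ρ) ^ (n * d)) ≤
      P {ω | ∀ i j, |X i ω j - 1 / 2| ≤ ρ} := by
    rw [hset, hfin]
    refine le_trans (le_of_eq ?_) (Finset.prod_le_prod' fun i _ => hi i)
    rw [Finset.prod_const, Finset.card_univ, Fintype.card_fin, ← ENNReal.ofReal_pow (by positivity),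
      mul_pow C₁, ← pow_mul, mul_comm d n]
  exact (ENNReal.ofReal_le_iff_le_toReal (measure_ne_top _ _)).1 this

lemma IsIIDWithDensity.ae_mem {Ω : Type*} [MeasurableSpace Ω] {P : Measure Ω}
    {n d : ℕ} {C₁ C₂ : ℝ} {X : Fin n → Ω → (Fin d → ℝ)}
    (h : IsIIDWithDensity P C₁ C₂ X) : ∀ᵐ ω ∂P, ∀ i j, 0 ≤ X i ω j ∧ X i ω j ≤ 1 := by
  obtain ⟨hm, -, f, -, -, hlaw⟩ := h
  rw [ae_all_iff]
  intro i
  have : ∀ᵐ x ∂(P.map (X i)), x ∈ Set.Icc (0 : Fin d → ℝ) 1 := by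
    rw [hlaw]
    exact (withDensity_absolutelyContinuous _ _).ae_le (ae_restrict_mem measurableSet_Icc)
  filter_upwards [ae_of_ae_map (hm i).aemeasurable this] with ω hω j
  exact ⟨hω.1 j, hω.2 j⟩

lemma IsRandomImage.ae_mem {Ω : Type*} [MeasurableSpace Ω] {P : Measure Ω}
    {M N : ℕ} {C₁ C₂ : ℝ} {Y : Ω → Matrix (Fin M) (Fin N) ℝ}
    (h : IsRandomImage P C₁ C₂ Y) : ∀ᵐ ω ∂P, ∀ i j, 0 ≤ Y ω i j ∧ Y ω i j ≤ 1 := by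
  rcases h with h | h
  · exact h.ae_mem
  · filter_upwards [h.ae_mem] with ω hω i j using hω j i

/-- Independent rows give the factor C₁^M, independent columns C₁^N; lowering C₁ to some c ≤ 1 lets
the larger exponent cover both. -/
lemma IsRandomImage.le_measureReal_box {Ω : Type*} [MeasurableSpace Ω] {P : Measure Ω}
    [IsProbabilityMeasure P] {M N : ℕ} {C₁ C₂ c : ℝ} {Y : Ω → Matrix (Fin M) (Fin N) ℝ}
    (hc : 0 ≤ c) (hcC : c ≤ C₁) (hc1 : c ≤ 1)
    (h : IsRandomImage P C₁ C₂ Y) {ρ : ℝ} (hρ0 : 0 ≤ ρ) (hρ : ρ ≤ 1 / 2) :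
    c ^ max N M * (2 * ρ) ^ (M * N) ≤ P.real {ω | ∀ i j, |Y ω i j - 1 / 2| ≤ ρ} := by
  have aux : ∀ k, k ≤ max N M →
      c ^ max N M * (2 * ρ) ^ (M * N) ≤ C₁ ^ k * (2 * ρ) ^ (M * N) := fun k hk =>
    mul_le_mul_of_nonneg_right
      ((pow_le_pow_of_le_one hc hc1 hk).trans (pow_le_pow_left₀ hc hcC k)) (by positivity)
  rcases h with h | h
  · exact (aux M (le_max_right _ _)).trans (h.le_measureReal_box (hc.trans hcC) hρ0 hρ)
  · refine (aux N (le_max_left _ _)).trans ?_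
    rw [mul_comm M N]
    refine (h.le_measureReal_box (hc.trans hcC) hρ0 hρ).trans (le_of_eq ?_)
    congr 1
    ext ω
    exact forall_comm

end NMF

/-! ### Size and ratios of the terms. -/

namespace NMF

lemma mu_eq (N M l : ℕ) (hN : 1 ≤ N) (hM : 1 ≤ M) :
    mu N M l = ((((max N M + 1) * (min N M - 1) + l.choose 2 : ℕ)) : ℝ) := by
  unfold mu
  rw [Nat.cast_add, Nat.cast_choose_two]
  rcases le_total N M with h | h
  · have : (N : ℝ) ≤ M := by exact_mod_cast h
    rw [max_eq_right h, min_eq_left h, abs_of_nonpos (by linarith)]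
    push_cast [hN]
    ring
  · have : (M : ℝ) ≤ N := by exact_mod_cast h
    rw [max_eq_left h, min_eq_right h, abs_of_nonneg (by linarith)]
    push_cast [hM]
    ring

lemma term_eq (N M : ℕ) (hN : 1 ≤ N) (hM : 1 ≤ M) (t : ℝ) (l : ℕ) :
    term N M t l = ((l : ℝ) ^ max N M - ((l : ℝ) - 1) ^ max N M) * (l ! : ℝ) *
      ((min N M : ℕ) : ℝ) * (t ^ ((max N M + 1) * (min N M - 1)) * t ^ l.choose 2) := by
  unfold term
  rw [mu_eq N M l hN hM, Real.rpow_natCast, pow_add]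
  push_cast
  rfl

lemma pow_sub_pow_nonneg (m : ℕ) {l : ℕ} (hl : 1 ≤ l) :
    0 ≤ (l : ℝ) ^ m - ((l : ℝ) - 1) ^ m := by
  have : (1 : ℝ) ≤ l := by exact_mod_cast hl
  exact sub_nonneg.2 (pow_le_pow_left₀ (by linarith) (by linarith) m)

lemma pow_sub_pow_pos {m : ℕ} (hm : 1 ≤ m) {l : ℕ} (hl : 1 ≤ l) :
    0 < (l : ℝ) ^ m - ((l : ℝ) - 1) ^ m := by
  have : (1 : ℝ) ≤ l := by exact_mod_cast hl
  exact sub_pos.2 (pow_lt_pow_left₀ (by linarith) (by linarith) (by omega))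

/-- Passing from l to l+1 multiplies by (l+1)t^l ≤ (l+1)/2^l ≤ 1. -/
lemma factorial_mul_pow_choose_le {t : ℝ} (ht0 : 0 ≤ t) (ht : t ≤ 1 / 2) (l : ℕ) :
    (l ! : ℝ) * t ^ l.choose 2 ≤ 1 := by
  induction l with
  | zero => simp
  | succ l ih =>
    have hc : (l + 1).choose 2 = l + l.choose 2 := by
      rw [Nat.choose_succ_succ' l 1, Nat.choose_one_right]
    rw [Nat.factorial_succ, hc, pow_add]
    push_cast
    have h2 : ((l : ℝ) + 1) * t ^ l ≤ 1 := by
      have h3 : (l : ℝ) + 1 ≤ 2 ^ l := by exact_mod_cast Nat.lt_two_pow_self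
      calc ((l : ℝ) + 1) * t ^ l ≤ 2 ^ l * t ^ l :=
            mul_le_mul_of_nonneg_right h3 (by positivity)
        _ = (2 * t) ^ l := (mul_pow _ _ _).symm
        _ ≤ 1 := pow_le_one₀ (by linarith) (by linarith)
    calc ((l : ℝ) + 1) * l ! * (t ^ l * t ^ l.choose 2)
        = (((l : ℝ) + 1) * t ^ l) * (l ! * t ^ l.choose 2) := by ring
      _ ≤ 1 * 1 := mul_le_mul h2 ih (by positivity) zero_le_one
      _ = 1 := one_mul 1

lemma sum_pow_sub_pow {m : ℕ} (hm : 1 ≤ m) (p : ℕ) :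
    ∑ l ∈ Finset.Icc 1 p, ((l : ℝ) ^ m - ((l : ℝ) - 1) ^ m) = (p : ℝ) ^ m := by
  induction p with
  | zero => simp [show m ≠ 0 by omega]
  | succ p ih =>
    rw [Finset.sum_Icc_succ_top (by omega), ih]
    push_cast
    ring

/-- Once l! t^(l(l-1)/2) is bounded by 1, the differences of powers telescope to p^m ≤ n^m, and n ≤
2^(n-1) absorbs n^(m+1) into the power of t. -/
lemma boundSum_le {N M : ℕ} (hN : 1 ≤ N) (hM : 1 ≤ M) {t : ℝ} (ht0 : 0 ≤ t) (ht : t ≤ 1 / 2)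
    {p : ℕ} (hp : p ≤ min N M) :
    boundSum N M t p ≤ (2 * t) ^ ((max N M + 1) * (min N M - 1)) := by
  unfold boundSum
  set m := max N M with hm
  set n := min N M with hn
  have hm1 : 1 ≤ m := hN.trans (le_max_left _ _)
  have hn1 : 1 ≤ n := le_min hN hM
  calc ∑ l ∈ Finset.Icc 1 p, term N M t l
      ≤ ∑ l ∈ Finset.Icc 1 p, ((l : ℝ) ^ m - ((l : ℝ) - 1) ^ m) *
          ((n : ℝ) * t ^ ((m + 1) * (n - 1))) := by
        refine Finset.sum_le_sum fun l hl => ?_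
        rw [term_eq N M hN hM]
        have h1 := pow_sub_pow_nonneg m (Finset.mem_Icc.1 hl).1
        calc _ = ((l : ℝ) ^ m - ((l : ℝ) - 1) ^ m) * ((n : ℝ) * t ^ ((m + 1) * (n - 1))) *
              ((l ! : ℝ) * t ^ l.choose 2) := by ring
          _ ≤ _ := mul_le_of_le_one_right (by positivity) (factorial_mul_pow_choose_le ht0 ht l)
    _ = (p : ℝ) ^ m * ((n : ℝ) * t ^ ((m + 1) * (n - 1))) := by
        rw [← Finset.sum_mul, sum_pow_sub_pow hm1]
    _ ≤ (n : ℝ) ^ m * ((n : ℝ) * t ^ ((m + 1) * (n - 1))) := by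
        gcongr
    _ = (n : ℝ) ^ (m + 1) * t ^ ((m + 1) * (n - 1)) := by ring
    _ ≤ ((2 : ℝ) ^ (n - 1)) ^ (m + 1) * t ^ ((m + 1) * (n - 1)) := by
        have : (n : ℝ) ≤ 2 ^ (n - 1) := by
          have h := Nat.lt_two_pow_self (n := n - 1)
          exact_mod_cast (by omega : n ≤ 2 ^ (n - 1))
        gcongr
    _ = _ := by rw [← pow_mul, mul_comm (n - 1), mul_pow]

lemma term_pos {N M : ℕ} (hN : 1 ≤ N) (hM : 1 ≤ M) {t : ℝ} (ht : 0 < t) {l : ℕ} (hl : 1 ≤ l) :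
    0 < term N M t l := by
  rw [term_eq N M hN hM]
  have h1 := pow_sub_pow_pos (hN.trans (le_max_left N M)) hl
  have h2 : (0 : ℝ) < ((min N M : ℕ) : ℝ) := by exact_mod_cast le_min hN hM
  positivity

lemma exists_term_succ_eq {N M : ℕ} (hN : 1 ≤ N) (hM : 1 ≤ M) {t : ℝ} (ht : 0 < t) {p : ℕ} :
    ∃ c : ℝ, 0 < c ∧
      term N M t p = c * ((p : ℝ) ^ max N M - ((p : ℝ) - 1) ^ max N M) ∧
      term N M t (p + 1) =
        c * ((((p : ℝ) + 1) ^ max N M - (p : ℝ) ^ max N M) * (((p : ℝ) + 1) * t ^ p)) := by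
  have h2 : (0 : ℝ) < ((min N M : ℕ) : ℝ) := by exact_mod_cast le_min hN hM
  refine ⟨(p ! : ℝ) * ((min N M : ℕ) : ℝ) *
    (t ^ ((max N M + 1) * (min N M - 1)) * t ^ p.choose 2), by positivity, ?_, ?_⟩
  · rw [term_eq N M hN hM]; ring
  · have hc : (p + 1).choose 2 = p + p.choose 2 := by
      rw [Nat.choose_succ_succ' p 1, Nat.choose_one_right]
    rw [term_eq N M hN hM, Nat.factorial_succ, hc, pow_add]
    push_cast
    ring

/-- Scaling by 1 + 1/p sends p to p+1 and p-1 to p - 1/p ≤ p, so the next difference is at most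
(1+1/p)^m times this one. -/
lemma pow_sub_pow_succ_le (m : ℕ) {p : ℕ} (hp : 1 ≤ p) :
    ((p : ℝ) + 1) ^ m - (p : ℝ) ^ m ≤
      Real.exp (m / p) * ((p : ℝ) ^ m - ((p : ℝ) - 1) ^ m) := by
  have hp1 : (1 : ℝ) ≤ p := by exact_mod_cast hp
  have hp0 : (0 : ℝ) < p := by linarith
  have h1 : ((p : ℝ) + 1) ^ m - (p : ℝ) ^ m ≤
      (1 + 1 / (p : ℝ)) ^ m * ((p : ℝ) ^ m - ((p : ℝ) - 1) ^ m) := by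
    rw [mul_sub, ← mul_pow, ← mul_pow]
    have e1 : (1 + 1 / (p : ℝ)) * p = p + 1 := by field_simp
    have e2 : (1 + 1 / (p : ℝ)) * (p - 1) ≤ p := by
      have : (1 + 1 / (p : ℝ)) * (p - 1) = p - 1 / p := by field_simp; ring
      rw [this]
      have : 0 ≤ 1 / (p : ℝ) := by positivity
      linarith
    rw [e1]
    have := pow_le_pow_left₀ (mul_nonneg (by positivity) (by linarith)) e2 m
    linarith
  refine h1.trans (mul_le_mul_of_nonneg_right ?_ (pow_sub_pow_nonneg m hp))
  calc (1 + 1 / (p : ℝ)) ^ m ≤ Real.exp (1 / p) ^ m := by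
        refine pow_le_pow_left₀ (by positivity) ?_ m
        linarith [Real.add_one_le_exp (1 / (p : ℝ))]
    _ = Real.exp (m / p) := by rw [← Real.exp_nat_mul]; congr 1; ring

/-- Discarding (p-1)^m leaves the ratio (1+1/p)^m - 1, and 1 + 1/p ≥ exp(1/(2p)). -/
lemma le_pow_sub_pow_succ (m : ℕ) {p : ℕ} (hp : 1 ≤ p) :
    (Real.exp (m / (2 * p)) - 1) * ((p : ℝ) ^ m - ((p : ℝ) - 1) ^ m) ≤
      ((p : ℝ) + 1) ^ m - (p : ℝ) ^ m := by
  have hp1 : (1 : ℝ) ≤ p := by exact_mod_cast hp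
  have hp0 : (0 : ℝ) < p := by linarith
  have hexp : Real.exp (1 / (2 * p)) ≤ 1 + 1 / p := by
    have hx : (1 : ℝ) / (2 * p) ≤ 1 / 2 := by
      rw [div_le_div_iff₀ (by positivity) (by positivity)]; linarith
    have h := Real.add_one_le_exp (-(1 / (2 * (p : ℝ))))
    rw [Real.exp_neg] at h
    have hE := Real.exp_pos (1 / (2 * (p : ℝ)))
    set x : ℝ := 1 / (2 * p) with hxd
    have hx0 : 0 < x := by positivity
    have hpx : 1 / (p : ℝ) = 2 * x := by rw [hxd]; field_simp
    rw [hpx]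
    have h' : (1 - x) * Real.exp x ≤ 1 := by
      calc (1 - x) * Real.exp x ≤ (Real.exp x)⁻¹ * Real.exp x := by gcongr; linarith
        _ = 1 := inv_mul_cancel₀ hE.ne'
    have : (1 - x) * (1 + 2 * x) ≥ 1 := by nlinarith
    by_contra! hcon
    nlinarith
  have h2 : Real.exp (m / (2 * p)) ≤ (1 + 1 / (p : ℝ)) ^ m := by
    calc Real.exp (m / (2 * p)) = Real.exp (1 / (2 * p)) ^ m := by
          rw [← Real.exp_nat_mul]; congr 1; ring
      _ ≤ _ := pow_le_pow_left₀ (Real.exp_pos _).le hexp m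
  have h3 : 0 ≤ Real.exp (m / (2 * p)) - 1 := by
    linarith [Real.one_le_exp (show (0 : ℝ) ≤ m / (2 * p) by positivity)]
  calc _ ≤ (Real.exp (m / (2 * p)) - 1) * (p : ℝ) ^ m := by
        refine mul_le_mul_of_nonneg_left ?_ h3
        have : 0 ≤ ((p : ℝ) - 1) ^ m := pow_nonneg (by linarith) m
        linarith
    _ ≤ ((1 + 1 / (p : ℝ)) ^ m - 1) * (p : ℝ) ^ m := by gcongr
    _ = _ := by
        rw [sub_mul, one_mul, ← mul_pow]
        congr 2
        field_simp

/-- Above a multiple of `pOpt` the terms decrease geometrically. -/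
lemma term_succ_le {N M : ℕ} (hN : 1 ≤ N) (hM : 1 ≤ M) {t η κ : ℝ} (ht : 0 < t)
    (htL : t ≤ Real.exp (-4)) (hη : 0 < η) (hκ : 2 ≤ κ) (hκη : -4 * Real.log η ≤ κ)
    {p : ℕ} (hp : κ * pOpt N M t < p) : term N M t (p + 1) ≤ η * term N M t p := by
  have hp0 : (0 : ℝ) < p :=
    lt_of_le_of_lt (mul_nonneg (by linarith) (Real.sqrt_nonneg _)) hp
  have hpn : 1 ≤ p := by exact_mod_cast hp0
  have hp1 : (1 : ℝ) ≤ p := by exact_mod_cast hpn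
  obtain ⟨c, hc, e1, e2⟩ := exists_term_succ_eq hN hM ht (p := p)
  have hlog : Real.log t ≤ -4 := by
    rw [← Real.log_exp (-4)]; exact Real.log_le_log ht htL
  unfold pOpt at hp
  rw [abs_of_neg (by linarith)] at hp
  set L := -Real.log t with hL
  have hL4 : 4 ≤ L := by linarith
  have htexp : t = Real.exp (-L) := by rw [hL, neg_neg, Real.exp_log ht]
  rw [show (max (N : ℝ) M) = ((max N M : ℕ) : ℝ) by push_cast; rfl] at hp
  set m := max N M with hm
  have hm1 : (1 : ℝ) ≤ m := by exact_mod_cast hN.trans (le_max_left N M)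
  have hsq : κ ^ 2 * m < p ^ 2 * L := by
    have h := pow_lt_pow_left₀ hp (mul_nonneg (by linarith) (Real.sqrt_nonneg _)) two_ne_zero
    rw [mul_pow, Real.sq_sqrt (by positivity), ← mul_div_assoc, div_lt_iff₀ (by linarith)] at h
    exact h
  have hpL : κ ≤ p * L := by
    by_contra! hcon
    have : (p : ℝ) ≤ κ := by nlinarith
    nlinarith
  have hmp : (m : ℝ) / p ≤ p * L / 4 := by
    rw [div_le_div_iff₀ hp0 (by norm_num)]
    have : (4 : ℝ) * m ≤ κ ^ 2 * m := by gcongr; nlinarith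
    nlinarith
  have hexp : Real.exp (m / p) * (((p : ℝ) + 1) * t ^ p) ≤ η := by
    calc Real.exp (m / p) * (((p : ℝ) + 1) * t ^ p)
        ≤ Real.exp (m / p) * (Real.exp p * Real.exp (-(p * L))) := by
          rw [htexp, ← Real.exp_nat_mul, mul_neg]
          gcongr
          exact Real.add_one_le_exp _
      _ = Real.exp (m / p + (p + -(p * L))) := by rw [Real.exp_add, Real.exp_add]
      _ ≤ Real.exp (Real.log η) := by
          refine Real.exp_le_exp.2 ?_
          -- With L ≥ 4, both m/p and p are at most pL/4, so the exponent is at most -pL/2, while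
          -- log η ≥ -κ/4 ≥ -pL/4.
          nlinarith
      _ = η := Real.exp_log hη
  rw [e1, e2]
  have hd := pow_sub_pow_nonneg m hpn
  calc c * ((((p : ℝ) + 1) ^ m - (p : ℝ) ^ m) * (((p : ℝ) + 1) * t ^ p))
      ≤ c * ((Real.exp (m / p) * ((p : ℝ) ^ m - ((p : ℝ) - 1) ^ m)) *
          (((p : ℝ) + 1) * t ^ p)) := by
        gcongr
        exact pow_sub_pow_succ_le m hpn
    _ = (Real.exp (m / p) * (((p : ℝ) + 1) * t ^ p)) *
          (c * ((p : ℝ) ^ m - ((p : ℝ) - 1) ^ m)) := by ring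
    _ ≤ _ := mul_le_mul_of_nonneg_right hexp (by positivity)

/-- Below a multiple of `pOpt` the terms do not decrease. -/
lemma lt_term_succ {N M : ℕ} (hN : 1 ≤ N) (hM : 1 ≤ M) {t η κ : ℝ} (ht : 0 < t)
    (htL : t ≤ Real.exp (-4)) (hη : η < 1) (hκ : 2 ≤ κ)
    {p : ℕ} (hpn : 1 ≤ p) (hp : κ * p ≤ pOpt N M t) :
    η * term N M t p < term N M t (p + 1) := by
  have hp1 : (1 : ℝ) ≤ p := by exact_mod_cast hpn
  have hp0 : (0 : ℝ) < p := by linarith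
  have hpos := term_pos hN hM ht hpn
  refine lt_of_lt_of_le (mul_lt_of_lt_one_left hpos hη) ?_
  obtain ⟨c, hc, e1, e2⟩ := exists_term_succ_eq hN hM ht (p := p)
  have hlog : Real.log t ≤ -4 := by
    rw [← Real.log_exp (-4)]; exact Real.log_le_log ht htL
  unfold pOpt at hp
  rw [abs_of_neg (by linarith)] at hp
  set L := -Real.log t with hL
  have hL4 : 4 ≤ L := by linarith
  have htexp : t = Real.exp (-L) := by rw [hL, neg_neg, Real.exp_log ht]
  rw [show (max (N : ℝ) M) = ((max N M : ℕ) : ℝ) by push_cast; rfl] at hp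
  set m := max N M with hm
  have hsq : κ ^ 2 * p ^ 2 * L ≤ m := by
    have h := pow_le_pow_left₀ (by positivity) hp 2
    rw [mul_pow, Real.sq_sqrt (by positivity), le_div_iff₀ (by linarith)] at h
    exact h
  -- The spare factor exp(pL) pays for the -1 in the lower bound on the ratio.
  have hmp : 2 * (p * L) ≤ m / (2 * p) := by
    rw [le_div_iff₀ (by positivity)]
    have : 4 * ((p : ℝ) ^ 2 * L) ≤ κ ^ 2 * (p ^ 2 * L) := by gcongr; nlinarith
    nlinarith
  have hpL : 4 ≤ p * L := by nlinarith
  have hexp : 1 ≤ (Real.exp (m / (2 * p)) - 1) * (((p : ℝ) + 1) * t ^ p) := by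
    have htp : t ^ p = Real.exp (-(p * L)) := by
      rw [htexp, ← Real.exp_nat_mul, mul_neg]
    have h1 : Real.exp (p * L) + 1 ≤ Real.exp (m / (2 * p)) := by
      have h2 : Real.exp (p * L) * Real.exp (p * L) ≤ Real.exp (m / (2 * p)) := by
        rw [← Real.exp_add]; exact Real.exp_le_exp.2 (by linarith)
      have h3 := Real.add_one_le_exp ((p : ℝ) * L)
      nlinarith
    calc (1 : ℝ) = Real.exp (p * L) * (1 * t ^ p) := by
          rw [htp, one_mul, ← Real.exp_add, add_neg_cancel, Real.exp_zero]
      _ ≤ _ := by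
          gcongr
          · linarith [Real.exp_pos ((p : ℝ) * L)]
          · linarith
          · linarith
  have hd := pow_sub_pow_nonneg m hpn
  rw [e1, e2]
  calc c * ((p : ℝ) ^ m - ((p : ℝ) - 1) ^ m)
      ≤ ((Real.exp (m / (2 * p)) - 1) * (((p : ℝ) + 1) * t ^ p)) *
          (c * ((p : ℝ) ^ m - ((p : ℝ) - 1) ^ m)) := le_mul_of_one_le_left (by positivity) hexp
    _ = c * (((Real.exp (m / (2 * p)) - 1) * ((p : ℝ) ^ m - ((p : ℝ) - 1) ^ m)) *
          (((p : ℝ) + 1) * t ^ p)) := by ring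
    _ ≤ _ := by
        gcongr
        exact le_pow_sub_pow_succ m hpn

/-- The ratio bound is equivalent to a_{l+1} ≤ η/(1-η) (a_l - a_{l+1}), which telescopes. -/
lemma boundSum_sub_le {N M : ℕ} {t η : ℝ} (hη0 : 0 ≤ η) (hη : η < 1) {p q : ℕ} (hpq : p ≤ q)
    (hpos : ∀ l, p ≤ l → 0 ≤ term N M t l)
    (h : ∀ l, p ≤ l → term N M t (l + 1) ≤ η * term N M t l) :
    boundSum N M t q - boundSum N M t p ≤ η / (1 - η) * term N M t p := by
  have h1 : 0 < 1 - η := by linarith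
  have key : boundSum N M t q - boundSum N M t p ≤
      η / (1 - η) * (term N M t p - term N M t q) := by
    induction q, hpq using Nat.le_induction with
    | base => simp
    | succ q hq ih =>
      have e : boundSum N M t (q + 1) = boundSum N M t q + term N M t (q + 1) := by
        unfold boundSum
        rw [Finset.sum_Icc_succ_top (by omega)]
      have : term N M t (q + 1) ≤ η / (1 - η) * (term N M t q - term N M t (q + 1)) := by
        rw [div_mul_eq_mul_div, le_div_iff₀ h1]
        nlinarith [h q hq]
      rw [e]
      linarith
  refine key.trans (mul_le_mul_of_nonneg_left ?_ (by positivity))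
  linarith [hpos q hpq]

end NMF
-- The probability bound.
namespace NMF

lemma eps_spec {K : ℝ} {N M : ℕ} {δ : ℝ} (hK : 1 < K) (hN : 1 ≤ N) (hM : 1 ≤ M) (hδ : 0 < δ) :
    0 < eps K N M δ ∧ eps K N M δ ≤ δ ∧ K * (M * N) * eps K N M δ < δ := by
  have hN1 : (1 : ℝ) ≤ N := by exact_mod_cast hN
  have hM1 : (1 : ℝ) ≤ M := by exact_mod_cast hM
  have hmin : (1 : ℝ) ≤ min (N : ℝ) M := le_min hN1 hM1
  have hNM : (1 : ℝ) ≤ N * M := by nlinarith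
  have hD : 1 ≤ K * N * M + (min N M : ℝ) ^ 2 := by nlinarith
  have he : eps K N M δ * (K * N * M + (min N M : ℝ) ^ 2) = δ := by
    unfold eps
    rw [mul_assoc, inv_mul_cancel₀ (by linarith), mul_one]
  have hpos : 0 < eps K N M δ := mul_pos hδ (inv_pos.2 (by linarith))
  refine ⟨hpos, by nlinarith, ?_⟩
  -- The summand min(N,M)² in ε makes the inequality strict.
  have : 0 < eps K N M δ * (min N M : ℝ) ^ 2 := by positivity
  linarith

/-- If `Y` is within squared distance `ε N M (< δ)` of a rank one matrix with entries in `[0,1]`,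
the minimum of the functional is below `δ`. -/
lemma IsMinimizer.J_lt {M N p : ℕ} (hp : 1 ≤ p) (hM : p ≤ M) (hN : p ≤ N) {α ν γ K δ : ℝ}
    (hK : 1 < K) (hδ : 0 < δ) (hν : 0 ≤ ν) (hγ : 0 ≤ γ)
    (hγν : γ + 2 * ν ≤ (K - 1) * eps K N M δ) {Y : Matrix (Fin M) (Fin N) ℝ}
    {U : Matrix (Fin M) (Fin p) ℝ} {S : Matrix (Fin p) (Fin p) ℝ} {V : Matrix (Fin p) (Fin N) ℝ}
    (h : IsMinimizer α ν γ Y U S V) (a : Fin M → ℝ) (b : Fin N → ℝ)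
    (ha0 : ∀ i, 0 ≤ a i) (ha1 : ∀ i, a i ≤ 1) (hb0 : ∀ i, 0 ≤ b i) (hb1 : ∀ i, b i ≤ 1)
    (hY : ∀ i j, |Y i j - a i * b j| ^ 2 ≤ eps K N M δ) :
    J α ν γ Y U S V < δ := by
  have h1 := h.J_le hp hM hN hν hγ a b ha0 ha1 hb0 hb1
  have h2 : ∑ i, ∑ j, |Y i j - a i * b j| ^ 2 ≤ M * N * eps K N M δ := by
    calc ∑ i, ∑ j, |Y i j - a i * b j| ^ 2 ≤ ∑ _i : Fin M, ∑ _j : Fin N, eps K N M δ :=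
          Finset.sum_le_sum fun i _ => Finset.sum_le_sum fun j _ => hY i j
      _ = M * N * eps K N M δ := by simp [mul_assoc]
  have h3 := mul_le_mul_of_nonneg_right hγν (show (0 : ℝ) ≤ M * N by positivity)
  have h4 := (eps_spec hK (hp.trans hN) (hp.trans hM) hδ).2.2
  linarith

lemma measureReal_J_lt_eq_one {Ω : Type*} [MeasurableSpace Ω] {P : Measure Ω}
    [IsProbabilityMeasure P] {M N p : ℕ} {C₁ C₂ α ν γ K δ : ℝ}
    {Y : Ω → Matrix (Fin M) (Fin N) ℝ}
    {U : Ω → Matrix (Fin M) (Fin p) ℝ} {S : Ω → Matrix (Fin p) (Fin p) ℝ}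
    {V : Ω → Matrix (Fin p) (Fin N) ℝ} (hY : IsRandomImage P C₁ C₂ Y) (hmin : min N M = 1)
    (hp1 : 1 ≤ p) (hp : p ≤ min N M) (hK : 1 < K) (hδ : 0 < δ) (hν : 0 ≤ ν) (hγ : 0 ≤ γ)
    (hγν : γ + 2 * ν ≤ (K - 1) * eps K N M δ)
    (h : ∀ᵐ ω ∂P, IsMinimizer α ν γ (Y ω) (U ω) (S ω) (V ω)) :
    P.real {ω | J α ν γ (Y ω) (U ω) (S ω) (V ω) < δ} = 1 := by
  have hpN : p ≤ N := hp.trans (min_le_left _ _)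
  have hpM : p ≤ M := hp.trans (min_le_right _ _)
  have he := (eps_spec hK (hp1.trans hpN) (hp1.trans hpM) hδ).1
  have hae : ∀ᵐ ω ∂P, J α ν γ (Y ω) (U ω) (S ω) (V ω) < δ := by
    filter_upwards [h, hY.ae_mem] with ω hω hYω
    rcases min_choice N M with hc | hc
    · obtain rfl : N = 1 := hc.symm.trans hmin
      refine hω.J_lt hp1 hpM hpN hK hδ hν hγ hγν (fun i => Y ω i 0) (fun _ => 1)
        (fun i => (hYω i 0).1) (fun i => (hYω i 0).2) (fun _ => zero_le_one) (fun _ => le_rfl)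
        fun i j => ?_
      rw [Subsingleton.elim j 0]
      simpa using he.le
    · obtain rfl : M = 1 := hc.symm.trans hmin
      refine hω.J_lt hp1 hpM hpN hK hδ hν hγ hγν (fun _ => 1) (fun j => Y ω 0 j)
        (fun _ => zero_le_one) (fun _ => le_rfl) (fun i => (hYω 0 i).1) (fun i => (hYω 0 i).2)
        fun i j => ?_
      rw [Subsingleton.elim i 0]
      simpa using he.le
  rw [measureReal_def, measure_congr (Filter.eventuallyEq_univ.2 hae), measure_univ, ENNReal.toReal_one]

lemma le_measureReal_J_lt {Ω : Type*} [MeasurableSpace Ω] {P : Measure Ω}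
    [IsProbabilityMeasure P] {M N p : ℕ} {C₁ C₂ c α ν γ K δ : ℝ}
    {Y : Ω → Matrix (Fin M) (Fin N) ℝ}
    {U : Ω → Matrix (Fin M) (Fin p) ℝ} {S : Ω → Matrix (Fin p) (Fin p) ℝ}
    {V : Ω → Matrix (Fin p) (Fin N) ℝ} (hY : IsRandomImage P C₁ C₂ Y) (hmin : 2 ≤ min N M)
    (hp1 : 1 ≤ p) (hp : p ≤ min N M) (hK : 1 < K) (hδ : 0 < δ) (hδ4 : δ ≤ 1 / 4)
    (hν : 0 ≤ ν) (hγ : 0 ≤ γ) (hc : 0 ≤ c) (hcC : c ≤ C₁) (hc1 : c ≤ 1)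
    (hγν : γ + 2 * ν ≤ (K - 1) * eps K N M δ)
    (h : ∀ᵐ ω ∂P, IsMinimizer α ν γ (Y ω) (U ω) (S ω) (V ω)) :
    (2 * (c * eps K N M δ)) ^ ((max N M + 1) * (min N M - 1)) ≤
      P.real {ω | J α ν γ (Y ω) (U ω) (S ω) (V ω) < δ} := by
  have hpN : p ≤ N := hp.trans (min_le_left _ _)
  have hpM : p ≤ M := hp.trans (min_le_right _ _)
  obtain ⟨he, heδ, -⟩ := eps_spec hK (hp1.trans hpN) (hp1.trans hpM) hδ
  set ε := eps K N M δ with hε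
  have hρ : √ε ≤ 1 / 2 := by
    rw [Real.sqrt_le_left (by norm_num)]
    linarith
  have hsub : P.real {ω | ∀ i j, |Y ω i j - 1 / 2| ≤ √ε} ≤
      P.real {ω | J α ν γ (Y ω) (U ω) (S ω) (V ω) < δ} := by
    refine ENNReal.toReal_mono (measure_ne_top _ _) (measure_mono_ae ?_)
    filter_upwards [h] with ω hω hYω
    refine hω.J_lt hp1 hpM hpN hK hδ hν hγ hγν (fun _ => 1) (fun _ => 1 / 2)
      (by intro _; norm_num) (by intro _; norm_num) (by intro _; norm_num)
      (by intro _; norm_num) fun i j => ?_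
    rw [one_mul, ← hε, ← Real.sq_sqrt he.le]
    exact pow_le_pow_left₀ (abs_nonneg _) (hYω i j) 2
  refine le_trans ?_ ((hY.le_measureReal_box hc hcC hc1 (Real.sqrt_nonneg ε) hρ).trans hsub)
  have hmn : M * N = max N M * min N M := by rw [max_mul_min, mul_comm]
  rw [hmn]
  obtain ⟨k, hk⟩ := Nat.exists_eq_add_of_le hmin
  rw [hk]
  set m := max N M
  set D := (m + 1) * (2 + k - 1) with hD
  have hD' : D = (m + 1) * (1 + k) := by rw [hD]; congr 1; omega
  have h1 : m ≤ D := by rw [hD']; nlinarith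
  have h2 : m * (2 + k) ≤ 2 * D := by rw [hD']; nlinarith
  -- Since 4ε = (2√ε)² and both c and 2√ε are at most 1, it only remains to compare exponents.
  calc (2 * (c * ε)) ^ D ≤ (c * (4 * ε)) ^ D := by
        refine pow_le_pow_left₀ (by positivity) ?_ D
        nlinarith [mul_nonneg hc he.le]
    _ = c ^ D * (2 * √ε) ^ (2 * D) := by
        rw [mul_pow, pow_mul (2 * √ε), mul_pow 2 (√ε), Real.sq_sqrt he.le]
        norm_num
    _ ≤ c ^ m * (2 * √ε) ^ (m * (2 + k)) :=
        mul_le_mul (pow_le_pow_of_le_one hc hc1 h1)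
          (pow_le_pow_of_le_one (by positivity) (by linarith) h2) (by positivity) (by positivity)

end NMF

/-! ### Choice of constants and assembly. -/

theorem mainTheorem2 :
    ∃ Kη : ℝ → ℝ, (∀ η : ℝ, 0 < η → η < 1 → 0 < Kη η) ∧
      ∀ C₁ C₂ : ℝ, 0 < C₁ → C₁ < C₂ →
        ∃ C₃ : ℝ, 0 < C₃ ∧ ∃ δ₀ : ℝ, 0 < δ₀ ∧
          ∀ (K : ℝ) (N M : ℕ) (δ : ℝ), 1 < K → 1 ≤ N → 1 ≤ M → 0 < δ → δ < δ₀ →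
            -- the probability bound
            (∀ (Ω : Type*) [MeasurableSpace Ω] (P : MeasureTheory.Measure Ω)
                [MeasureTheory.IsProbabilityMeasure P]
                (Y : Ω → Matrix (Fin M) (Fin N) ℝ) (p : ℕ) (α ν γ : ℝ)
                (U : Ω → Matrix (Fin M) (Fin p) ℝ) (S : Ω → Matrix (Fin p) (Fin p) ℝ)
                (V : Ω → Matrix (Fin p) (Fin N) ℝ),
                NMF.IsRandomImage P C₁ C₂ Y →
                p ≤ min N M →
                0 ≤ α → 0 ≤ ν → 0 ≤ γ →
                γ + 2 * ν ≤ (K - 1) * NMF.eps K N M δ →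
                (∀ᵐ ω ∂P, NMF.IsMinimizer α ν γ (Y ω) (U ω) (S ω) (V ω)) →
                NMF.boundSum N M (C₃ * NMF.eps K N M δ) p ≤
                  P.real {ω | NMF.J α ν γ (Y ω) (U ω) (S ω) (V ω) < δ}) ∧
            -- the growth of the sum in `p`
            (∀ η : ℝ, 0 < η → η < 1 →
              (∀ p : ℕ, Kη η * NMF.pOpt N M (C₃ * NMF.eps K N M δ) < p →
                NMF.term N M (C₃ * NMF.eps K N M δ) (p + 1) ≤
                    η * NMF.term N M (C₃ * NMF.eps K N M δ) p ∧
                ∀ q : ℕ, p ≤ q →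
                  NMF.boundSum N M (C₃ * NMF.eps K N M δ) q
                      - NMF.boundSum N M (C₃ * NMF.eps K N M δ) p ≤
                    η / (1 - η) * NMF.term N M (C₃ * NMF.eps K N M δ) p) ∧
              (∀ p : ℕ, 1 ≤ p → Kη η * p ≤ NMF.pOpt N M (C₃ * NMF.eps K N M δ) →
                η * NMF.term N M (C₃ * NMF.eps K N M δ) p <
                  NMF.term N M (C₃ * NMF.eps K N M δ) (p + 1))) := by
  -- δ₀ = exp(-4) gives |log t| ≥ 4 and √ε ≤ 1/2; C₃ ≤ 1 gives t ≤ ε, and C₃ ≤ C₁ serves the density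
  -- bound.
  refine ⟨fun η => 2 + |4 * Real.log η|, fun η _ _ => by positivity,
    fun C₁ C₂ hC₁ _ => ⟨min 1 C₁, lt_min one_pos hC₁, Real.exp (-4), Real.exp_pos _, ?_⟩⟩
  intro K N M δ hK hN hM hδ hδ₀
  obtain ⟨he, heδ, -⟩ := NMF.eps_spec hK hN hM hδ
  have hc : 0 < min 1 C₁ := lt_min one_pos hC₁
  have ht : 0 < min 1 C₁ * NMF.eps K N M δ := mul_pos hc he
  have hteps : min 1 C₁ * NMF.eps K N M δ ≤ NMF.eps K N M δ :=
    mul_le_of_le_one_left he.le (min_le_left _ _)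
  have htL : min 1 C₁ * NMF.eps K N M δ ≤ Real.exp (-4) := by linarith
  have hexp : Real.exp (-4) ≤ 1 / 4 := by
    rw [Real.exp_neg, one_div]
    exact inv_anti₀ (by norm_num) (by linarith [Real.add_one_le_exp (4 : ℝ)])
  refine ⟨?_, fun η hη0 hη1 => ⟨fun p hp => ?_, fun p hp1 hp => ?_⟩⟩
  · intro Ω _ P _ Y p α ν γ U S V hY hp _ hν hγ hγν hmin
    rcases Nat.eq_zero_or_pos p with rfl | hp1
    · simp [NMF.boundSum]
    refine (NMF.boundSum_le hN hM ht.le (by linarith) hp).trans ?_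
    rcases (le_min hN hM : 1 ≤ min N M).eq_or_lt with h1 | h2
    · rw [NMF.measureReal_J_lt_eq_one hY h1.symm hp1 hp hK hδ hν hγ hγν hmin, ← h1]
      simp
    · exact NMF.le_measureReal_J_lt hY h2 hp1 hp hK hδ (by linarith) hν hγ hc.le
        (min_le_right _ _) (min_le_left _ _) hγν hmin
  · have hκ : -4 * Real.log η ≤ 2 + |4 * Real.log η| := by
      linarith [neg_le_abs (4 * Real.log η)]
    have hκ2 : 2 ≤ 2 + |4 * Real.log η| := by linarith [abs_nonneg (4 * Real.log η)]
    have hstep : ∀ l, p ≤ l → NMF.term N M (min 1 C₁ * NMF.eps K N M δ) (l + 1) ≤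
        η * NMF.term N M (min 1 C₁ * NMF.eps K N M δ) l := fun l hl =>
      NMF.term_succ_le hN hM ht htL hη0 hκ2 hκ (hp.trans_le (by exact_mod_cast hl))
    have hp0 : 1 ≤ p := by
      have : (0 : ℝ) < p :=
        lt_of_le_of_lt (mul_nonneg (by positivity) (Real.sqrt_nonneg _)) hp
      exact_mod_cast this
    exact ⟨hstep p le_rfl, fun q hq => NMF.boundSum_sub_le hη0.le hη1 hq
      (fun l hl => (NMF.term_pos hN hM ht (hp0.trans hl)).le) hstep⟩
  · exact NMF.lt_term_succ hN hM ht htL hη1 (by linarith [abs_nonneg (4 * Real.log η)]) hp1 hp
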